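/- Let $p$ be a prime and $X$ a group acting by automorphisms on a nilpotent group $R$ (so $R$ is an $X$-group) that is radicable, i.e. for every $g\in R$ and every nonzero integer $n$ there is $x\in R$ with $x^n=g$. Let $P$ be the torsion subgroup of $R$ (the set of elements of finite order), and assume that $P$ is $p$-minimax: $P$ has a series $1=S_0\unlhd S_1\unlhd\cdots\unlhd S_r=P$ in which each factor $S_{i+1}/S_i$ is finite, infinite cyclic, or isomorphic to $\mathbb Z(q^\infty)=\mathbb Z[1/q]/\mathbb Z$ for some prime $q$, and no quotient of a subgroup of $P$ is isomorphic to $\mathbb Z(q^\infty)$ for a prime $q\neq p$. Then there exist a nilpotent radicable $X$-group $\bar R$ and an $X$-equivariant epimorphism $\psi:\bar R\to R$ such that there is an $X$-equivariant group isomorphism $\nu:P\to\psi^{-1}(P)$ with $\psi(\nu(u))=u^p$ for all $u\in P$. Furthermore, for every $\bar R$ and $\psi$ with these properties, the abelianizations satisfy $\mathrm{Ann}_{\mathbb ZX}(\bar R_{\mathrm{ab}})=\mathrm{Ann}_{\mathbb ZX}(R_{\mathrm{ab}})$. -/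

import Mathlib

universe u v

/-- A group is radicable if every element has an `n`-th root for every nonzero integer `n`. -/
def IsRadicable (G : Type*) [Group G] : Prop :=
  ∀ n : ℤ, n ≠ 0 → ∀ g : G, ∃ x : G, x ^ n = g

/-- The quasicyclic group `ℤ(p^∞) = ℤ[1/p] / ℤ`, written additively. -/
abbrev QuasicyclicGroup (p : ℕ) : Type :=
  Localization.Away (p : ℤ) ⧸ (Int.castAddHom (Localization.Away (p : ℤ))).range

/-- The group `G` is isomorphic to `ℤ(p^∞)`. -/
def IsQuasicyclic (p : ℕ) (G : Type*) [Group G] : Prop :=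
  Nonempty (G ≃* Multiplicative (QuasicyclicGroup p))

/-- A factor of a minimax series: finite, infinite cyclic, or quasicyclic (for some prime). -/
def IsMinimaxFactor (G : Type*) [Group G] : Prop :=
  Finite G ∨ (IsCyclic G ∧ Infinite G) ∨ ∃ q : ℕ, q.Prime ∧ IsQuasicyclic q G

/-- Virtually solvable minimax groups: there is a series `1 = S 0 ⊴ S 1 ⊴ ⋯ ⊴ S r = G` each of
whose factors is finite, infinite cyclic, or quasicyclic. -/
def IsMinimaxGroup (G : Type*) [Group G] : Prop :=
  ∃ (r : ℕ) (S : ℕ → Subgroup G), S 0 = ⊥ ∧ S r = ⊤ ∧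
    ∀ i < r, S i ≤ S (i + 1) ∧
      ∃ _ : ((S i).subgroupOf (S (i + 1))).Normal,
        IsMinimaxFactor (↥(S (i + 1)) ⧸ (S i).subgroupOf (S (i + 1)))

/-- The spectrum of `G`: the primes `q` such that some section of `G` is isomorphic to
`ℤ(q^∞)`. -/
def groupSpectrum (G : Type*) [Group G] : Set ℕ :=
  {q | q.Prime ∧ ∃ (H : Subgroup G) (K : Subgroup H) (_ : K.Normal), IsQuasicyclic q (H ⧸ K)}

/-- `π`-minimax groups: minimax groups whose spectrum is contained in the set of primes `π`. -/
def IsPiMinimax (π : Set ℕ) (G : Type*) [Group G] : Prop :=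
  IsMinimaxGroup G ∧ groupSpectrum G ⊆ π

section

open scoped commutatorElement

/-- Modulo the next term, the elements of a term of the lower central series are central. -/
theorem commute_mk_lowerCentralSeries {G : Type*} [Group G] (n : ℕ) {g : G}
    (hg : g ∈ (⊤ : Subgroup G).lowerCentralSeries n) (h : G) :
    Commute (g : G ⧸ (⊤ : Subgroup G).lowerCentralSeries (n + 1)) h := by
  have h1 : ⁅g, h⁆ ∈ (⊤ : Subgroup G).lowerCentralSeries (n + 1) :=
    Subgroup.commutator_mem_commutator hg (Subgroup.mem_top h)
  have h2 := (QuotientGroup.eq_one_iff (N := (⊤ : Subgroup G).lowerCentralSeries (n + 1)) _).2 h1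
  rw [← commutatorElement_eq_one_iff_commute]
  exact h2

/-- If `G` is generated by elements of finite order, then each term of its lower central series
is torsion modulo the next one. -/
theorem isOfFinOrder_mk_lowerCentralSeries {G : Type*} [Group G]
    (hG : Subgroup.closure {x : G | IsOfFinOrder x} = ⊤) (n : ℕ) :
    ∀ g ∈ (⊤ : Subgroup G).lowerCentralSeries n,
      IsOfFinOrder (g : G ⧸ (⊤ : Subgroup G).lowerCentralSeries (n + 1)) := by
  induction n with
  | zero =>
    intro g _
    have hg : g ∈ Subgroup.closure {x : G | IsOfFinOrder x} := hG ▸ Subgroup.mem_top g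
    induction hg using Subgroup.closure_induction with
    | mem x hx => exact (QuotientGroup.mk' _).isOfFinOrder hx
    | one => exact IsOfFinOrder.one
    | mul x y _ _ hx hy =>
      exact (commute_mk_lowerCentralSeries 0 (Subgroup.mem_top x) y).isOfFinOrder_mul
        (hx (Subgroup.mem_top x)) (hy (Subgroup.mem_top y))
    | inv x _ hx => exact (hx (Subgroup.mem_top x)).inv
  | succ n ih =>
    intro g hg
    have hg' : g ∈ Subgroup.closure
        {x | ∃ p ∈ (⊤ : Subgroup G).lowerCentralSeries n, ∃ q ∈ (⊤ : Subgroup G), ⁅p, q⁆ = x} := hg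
    clear hg
    suffices H : g ∈ (⊤ : Subgroup G).lowerCentralSeries (n + 1) ∧
        IsOfFinOrder (g : G ⧸ (⊤ : Subgroup G).lowerCentralSeries (n + 1 + 1)) from H.2
    induction hg' using Subgroup.closure_induction with
    | mem x hx =>
      obtain ⟨a, ha, b, hb, rfl⟩ := hx
      have hc : ⁅a, b⁆ ∈ (⊤ : Subgroup G).lowerCentralSeries (n + 1) :=
        Subgroup.commutator_mem_commutator ha hb
      refine ⟨hc, ?_⟩
      obtain ⟨k, hk, hak⟩ := isOfFinOrder_iff_pow_eq_one.1 (ih a ha)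
      refine isOfFinOrder_iff_pow_eq_one.2 ⟨k, hk, ?_⟩
      have hak' : a ^ k ∈ (⊤ : Subgroup G).lowerCentralSeries (n + 1) :=
        (QuotientGroup.eq_one_iff _).1 ((QuotientGroup.mk_pow _ a k).trans hak)
      have hcomm := commute_mk_lowerCentralSeries (n + 1) hak' b
      have hcen := commute_mk_lowerCentralSeries (n + 1) hc a
      have hconj : ((b * a * b⁻¹ : G) : G ⧸ (⊤ : Subgroup G).lowerCentralSeries (n + 1 + 1)) =
          ((⁅a, b⁆⁻¹ : G) : G ⧸ (⊤ : Subgroup G).lowerCentralSeries (n + 1 + 1)) * a := by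
        have : b * a * b⁻¹ = ⁅a, b⁆⁻¹ * a := by rw [commutatorElement_def]; group
        rw [this]; rfl
      have hpow := congrArg (· ^ k) hconj
      have hcen' : Commute
          ((⁅a, b⁆⁻¹ : G) : G ⧸ (⊤ : Subgroup G).lowerCentralSeries (n + 1 + 1)) a :=
        hcen.inv_left
      simp only [hcen'.mul_pow] at hpow
      rw [QuotientGroup.mk_mul, QuotientGroup.mk_mul, QuotientGroup.mk_inv, conj_pow,
        ← QuotientGroup.mk_pow, ← hcomm.eq, mul_inv_cancel_right, QuotientGroup.mk_inv,
        inv_pow] at hpow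
      exact inv_eq_one.1 (right_eq_mul.1 hpow)
    | one => exact ⟨Subgroup.one_mem _, IsOfFinOrder.one⟩
    | mul x y _ _ hx hy =>
      exact ⟨Subgroup.mul_mem _ hx.1 hy.1,
        (commute_mk_lowerCentralSeries (n + 1) hx.1 y).isOfFinOrder_mul hx.2 hy.2⟩
    | inv x _ hx => exact ⟨Subgroup.inv_mem _ hx.1, hx.2.inv⟩

end

/-- A nilpotent group generated by elements of finite order is a torsion group. -/
theorem isOfFinOrder_of_closure_eq_top {G : Type*} [Group G] [hN : Group.IsNilpotent G]
    (hG : Subgroup.closure {x : G | IsOfFinOrder x} = ⊤) (g : G) : IsOfFinOrder g := by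
  have key : ∀ n : ℕ, ∃ k : ℕ, 0 < k ∧ g ^ k ∈ (⊤ : Subgroup G).lowerCentralSeries n := by
    intro n
    induction n with
    | zero => exact ⟨1, one_pos, Subgroup.mem_top _⟩
    | succ n ih =>
      obtain ⟨k, hk, hgk⟩ := ih
      obtain ⟨m, hm, hgm⟩ :=
        isOfFinOrder_iff_pow_eq_one.1 (isOfFinOrder_mk_lowerCentralSeries hG n _ hgk)
      refine ⟨k * m, Nat.mul_pos hk hm, (QuotientGroup.eq_one_iff _).1 ?_⟩
      rw [pow_mul]
      exact (QuotientGroup.mk_pow _ (g ^ k) m).trans hgm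
  obtain ⟨n, hn⟩ := Subgroup.nilpotent_iff_lowerCentralSeries.1 hN
  obtain ⟨k, hk, hgk⟩ := key n
  rw [hn, Subgroup.mem_bot] at hgk
  exact isOfFinOrder_iff_pow_eq_one.2 ⟨k, hk, hgk⟩

/-- In a nilpotent group the product of two elements of finite order has finite order. -/
theorem isOfFinOrder_mul_of_isNilpotent {G : Type*} [Group G] [Group.IsNilpotent G] {x y : G}
    (hx : IsOfFinOrder x) (hy : IsOfFinOrder y) : IsOfFinOrder (x * y) := by
  let T : Subgroup G := Subgroup.closure {x : G | IsOfFinOrder x}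
  have hT : Subgroup.closure {x : T | IsOfFinOrder x} = ⊤ := by
    have h := Subgroup.closure_closure_coe_preimage (k := {x : G | IsOfFinOrder x})
    have h2 : {x : T | IsOfFinOrder x} = Subtype.val ⁻¹' {x : G | IsOfFinOrder x} := by
      ext z
      exact Submonoid.isOfFinOrder_coe.symm
    rw [h2]
    exact h
  have hxy : x * y ∈ T :=
    T.mul_mem (Subgroup.subset_closure hx) (Subgroup.subset_closure hy)
  exact Submonoid.isOfFinOrder_coe.2 (isOfFinOrder_of_closure_eq_top hT ⟨x * y, hxy⟩)

/-- The torsion subgroup of a nilpotent group: the subgroup of all elements of finite order. -/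
def nilTorsion (G : Type*) [Group G] [Group.IsNilpotent G] : Subgroup G where
  carrier := {x | IsOfFinOrder x}
  one_mem' := IsOfFinOrder.one
  inv_mem' := fun h => h.inv
  mul_mem' := fun hx hy => isOfFinOrder_mul_of_isNilpotent hx hy

/-- The torsion subgroup is invariant under every group action by automorphisms. -/
theorem smul_mem_nilTorsion {X G : Type*} [Group X] [Group G] [Group.IsNilpotent G]
    [MulDistribMulAction X G] (x : X) {u : G} (hu : u ∈ nilTorsion G) :
    x • u ∈ nilTorsion G :=
  (MulDistribMulAction.toMonoidHom G x).isOfFinOrder hu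

/-- The action of `X` on the abelianization of an `X`-group `G`, as a representation over `ℤ`. -/
def abelianizationRep (X G : Type*) [Group X] [Group G] [MulDistribMulAction X G] :
    Representation ℤ X (Additive (Abelianization G)) where
  toFun x := (MonoidHom.toAdditive
    (Abelianization.map (MulDistribMulAction.toMonoidHom G x))).toIntLinearMap
  map_one' := by
    ext g
    induction g using QuotientGroup.induction_on with
    | H z => exact congrArg (fun t : G => Additive.ofMul (Abelianization.of t)) (one_smul X z)
  map_mul' x y := by
    ext g
    induction g using QuotientGroup.induction_on with
    | H z => exact congrArg (fun t : G => Additive.ofMul (Abelianization.of t)) (mul_smul x y z)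

/-- The annihilator in the group ring `ℤX` of the `ℤX`-module `G_ab`. -/
noncomputable def abAnnihilator (X G : Type*) [Group X] [Group G] [MulDistribMulAction X G] :
    Ideal (MonoidAlgebra ℤ X) :=
  Module.annihilator (MonoidAlgebra ℤ X) (abelianizationRep X G).asModule

/-- `Rbar` is a radicable nilpotent `X`-group and `ψ : Rbar → R` is an epimorphism of `X`-groups
such that, for the torsion subgroup `P` of `R`, there is an isomorphism of `X`-groups
`ν : P → ψ⁻¹(P)` with `ψ (ν u) = u ^ p` for all `u ∈ P`. -/
structure IsPowerCover (X : Type*) [Group X] (p : ℕ)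
    {R : Type*} [Group R] [Group.IsNilpotent R] [MulDistribMulAction X R]
    {Rbar : Type*} [Group Rbar] [MulDistribMulAction X Rbar] (ψ : Rbar →* R) : Prop where
  nilpotent : Group.IsNilpotent Rbar
  radicable : IsRadicable Rbar
  surjective : Function.Surjective ψ
  equivariant : ∀ (x : X) (r : Rbar), ψ (x • r) = x • ψ r
  exists_iso : ∃ ν : nilTorsion R ≃* (nilTorsion R).comap ψ,
    (∀ (x : X) (u : nilTorsion R),
      (ν ⟨x • (u : R), smul_mem_nilTorsion x u.2⟩ : Rbar) = x • (ν u : Rbar)) ∧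
    ∀ u : nilTorsion R, ψ (ν u : Rbar) = (u : R) ^ p

/-!
If an automorphism of a nilpotent group `G` induces the `n`-th power map on `G_ab`, then it induces
the `n ^ (i + 1)`-th power map on the `i`-th factor `γ_i / γ_{i+1}` of the lower central series, so
`n`-th roots exist uniquely in every factor, and hence in `G`. The shift is such an automorphism,
with `n = p`, of the group `G` generated by the sequences `f : ℤ → R` with `f (i + 1) = f i ^ p`,
and `f ↦ f 0` maps `G` onto the radicable group `R`. The torsion subgroup `P` of `R` is central,
so this map factors through `E = G / [S, G]`, where `S` is the preimage of `P`; in `E` the preimage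
of `P` is central and uniquely `p`-divisible. Dividing `E` by the `p`-th powers of the elements of
the kernel `K` of `E → R` turns `s ↦ s ^ p` into an isomorphism from `P` (the preimage of `P`
modulo `K`) onto the preimage of `P` in the quotient.

For every power cover, the kernel of `Rbar_ab → R_ab` is killed by `p` while `Rbar_ab` is
`p`-divisible. So if `a` annihilates `R_ab`, then `a • (p • v) = p • (a • v) = 0` for all `v`.
-/

open Subgroup
open scoped commutatorElement IsMulCommutative

section Commutators

variable {G : Type*} [Group G]

theorem commutatorElement_mul_left_of_commute {c b : G} (h : Commute c b) (a : G) :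
    ⁅a * c, b⁆ = ⁅a, b⁆ := by
  rw [commutatorElement_mul_left_eq_conj_mul, h.commutator_eq, mul_one, mul_inv_cancel, one_mul]

theorem commutatorElement_pow_left {a b : G} (h : Commute ⁅a, b⁆ a) (n : ℕ) :
    ⁅a ^ n, b⁆ = ⁅a, b⁆ ^ n := by
  have h_conj : b * a * b⁻¹ = ⁅a, b⁆⁻¹ * a := by rw [commutatorElement_def]; group
  calc ⁅a ^ n, b⁆ = a ^ n * ((b * a * b⁻¹) ^ n)⁻¹ := by
        rw [conj_pow, commutatorElement_def]; group
    _ = ⁅a, b⁆ ^ n := by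
        rw [h_conj, h.inv_left.mul_pow, mul_inv_rev, inv_pow, inv_inv, mul_inv_cancel_left]

/-- The homomorphism `b ↦ ⁅a, b⁆` attached to an element `a` of the second centre. -/
def centralCommutatorHom (a : G) (ha : ∀ b, ⁅a, b⁆ ∈ center G) : G →* center G :=
  MonoidHom.mk' (fun b => ⟨⁅a, b⁆, ha b⟩) fun b c => Subtype.ext <|
    calc ⁅a, b * c⁆ = ⁅a, b⁆ * (b * ⁅a, c⁆ * b⁻¹) := by
          rw [commutatorElement_mul_right_eq_mul_conj]; group
      _ = ⁅a, b⁆ * ⁅a, c⁆ := by rw [mem_center_iff.1 (ha c), mul_inv_cancel_right]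

theorem commutatorElement_eq_pow_of_abelianization {a b c : G} (ha : ∀ g, ⁅a, g⁆ ∈ center G)
    {n : ℕ} (h : Abelianization.of c = Abelianization.of b ^ n) : ⁅a, c⁆ = ⁅a, b⁆ ^ n := by
  have h_lift := congrArg (Abelianization.lift (centralCommutatorHom a ha)) h
  rw [map_pow, Abelianization.lift_apply_of, Abelianization.lift_apply_of] at h_lift
  exact congrArg Subtype.val h_lift

theorem commutatorElement_pow_right {a b : G} (ha : ∀ g, ⁅a, g⁆ ∈ center G) (n : ℕ) :
    ⁅a, b ^ n⁆ = ⁅a, b⁆ ^ n :=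
  commutatorElement_eq_pow_of_abelianization ha (map_pow _ b n)

theorem commute_mk'_commutator {H : Subgroup G} [H.Normal] {x : G} (hx : x ∈ H)
    (y : G ⧸ ⁅H, (⊤ : Subgroup G)⁆) : Commute (QuotientGroup.mk' ⁅H, (⊤ : Subgroup G)⁆ x) y := by
  induction y using QuotientGroup.induction_on with
  | H y =>
    rw [← commutatorElement_eq_one_iff_commute]
    exact (QuotientGroup.eq_one_iff _).2 (commutator_mem_commutator hx (mem_top y))

end Commutators

section Roots

variable {G : Type*} [Group G]

theorem IsRadicable.of_surjective {H : Type*} [Group H] (hG : IsRadicable G) {f : G →* H}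
    (hf : Function.Surjective f) : IsRadicable H := by
  intro n hn h
  obtain ⟨g, rfl⟩ := hf h
  obtain ⟨x, rfl⟩ := hG n hn g
  exact ⟨f x, (map_zpow f x n).symm⟩

theorem IsRadicable.mem_center_of_isOfFinOrder [Group.IsNilpotent G] (hG : IsRadicable G) {u : G}
    (hu : IsOfFinOrder u) : u ∈ center G := by
  refine Group.nilpotent_center_quotient_ind
    (P := fun G _ _ => IsRadicable G → ∀ u : G, IsOfFinOrder u → u ∈ center G) G ?_ ?_ hG u hu
  · intro G _ _ _ u _
    exact mem_center_iff.2 fun g => Subsingleton.elim _ _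
  · intro G _ _ ih hG u hu
    have h_mk : (u : G ⧸ center G) ∈ center (G ⧸ center G) :=
      ih (hG.of_surjective (QuotientGroup.mk'_surjective _)) u
        ((QuotientGroup.mk' (center G)).isOfFinOrder hu)
    have h_comm : ∀ g, ⁅u, g⁆ ∈ center G := fun g =>
      (QuotientGroup.eq_one_iff _).1
        (commutatorElement_eq_one_iff_commute.2 (mem_center_iff.1 h_mk g).symm)
    obtain ⟨k, hk, huk⟩ := isOfFinOrder_iff_pow_eq_one.1 hu
    refine mem_center_iff.2 fun g => ?_
    obtain ⟨s, rfl⟩ := hG k (mod_cast hk.ne') g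
    refine (commutatorElement_eq_one_iff_commute.1 ?_).symm
    calc ⁅u, s ^ (k : ℤ)⁆ = ⁅u, s⁆ ^ k := by
          rw [zpow_natCast, commutatorElement_pow_right h_comm]
      _ = ⁅u ^ k, s⁆ := (commutatorElement_pow_left (mem_center_iff.1 (h_comm s) u).symm k).symm
      _ = 1 := by rw [huk, commutatorElement_one_left]

/-- Every element of `H` is an `n`-th power of an element of `H` modulo `⁅H, G⁆`. -/
def HasRootsModCommutator (n : ℕ) (H : Subgroup G) : Prop :=
  ∀ z ∈ H, ∃ w ∈ H, (w ^ n)⁻¹ * z ∈ ⁅H, (⊤ : Subgroup G)⁆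

theorem HasRootsModCommutator.commutator {n : ℕ} {H : Subgroup G} [H.Normal]
    (hH : HasRootsModCommutator n H) : HasRootsModCommutator n ⁅H, (⊤ : Subgroup G)⁆ := by
  set K := ⁅H, (⊤ : Subgroup G)⁆ with hK
  let π := QuotientGroup.mk' ⁅K, (⊤ : Subgroup G)⁆
  suffices ∀ z ∈ K, ∃ w ∈ K, π w ^ n = π z by
    intro z hz
    obtain ⟨w, hw, hwz⟩ := this z hz
    exact ⟨w, hw, QuotientGroup.eq.1 hwz⟩
  intro z hz
  rw [hK, Subgroup.commutator_def] at hz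
  induction hz using closure_induction with
  | mem z hz =>
    obtain ⟨h, hh, g, -, rfl⟩ := hz
    obtain ⟨w, hw, hwh⟩ := hH h hh
    have hwg : ⁅w, g⁆ ∈ K := commutator_mem_commutator hw (mem_top g)
    refine ⟨⁅w, g⁆, hwg, ?_⟩
    calc π ⁅w, g⁆ ^ n = ⁅π w ^ n, π g⁆ := by
          rw [map_commutatorElement, commutatorElement_pow_left]
          exact commute_mk'_commutator hwg (π w)
      _ = ⁅π w ^ n * π ((w ^ n)⁻¹ * h), π g⁆ :=
          (commutatorElement_mul_left_of_commute (commute_mk'_commutator hwh (π g)) _).symm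
      _ = π ⁅h, g⁆ := by
          rw [← map_pow, ← map_mul, mul_inv_cancel_left, map_commutatorElement]
  | one => exact ⟨1, one_mem _, one_pow n⟩
  | mul x y _ _ hx hy =>
    obtain ⟨a, ha, hax⟩ := hx
    obtain ⟨b, hb, hby⟩ := hy
    exact ⟨a * b, mul_mem ha hb, by
      rw [map_mul, map_mul, (commute_mk'_commutator ha (π b)).mul_pow, hax, hby]⟩
  | inv x _ hx =>
    obtain ⟨a, ha, hax⟩ := hx
    exact ⟨a⁻¹, inv_mem ha, by rw [map_inv, map_inv, inv_pow, hax]⟩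

theorem HasRootsModCommutator.exists_pow_eq [hG : Group.IsNilpotent G] {n : ℕ}
    {H : Subgroup G} [H.Normal] (hH : HasRootsModCommutator n H) :
    ∀ z ∈ H, ∃ w ∈ H, w ^ n = z := by
  obtain ⟨c, hc⟩ := Subgroup.nilpotent_iff_lowerCentralSeries.1 hG
  suffices key : ∀ i ≤ c, ∀ H : Subgroup G, H.Normal →
      H ≤ (⊤ : Subgroup G).lowerCentralSeries i → HasRootsModCommutator n H →
      ∀ g, ∀ z ∈ H, ∃ w ∈ H, (g * w) ^ n = g ^ n * z by
    intro z hz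
    simpa using key 0 c.zero_le H ‹_› le_top hH 1 z hz
  intro i hi
  induction hi using Nat.decreasingInduction with
  | self =>
    intro H _ hle _ g z hz
    obtain rfl : z = 1 := by simpa [hc] using hle hz
    exact ⟨1, one_mem H, by simp⟩
  | of_succ i _ ih =>
    intro H _ hle hroots g z hz
    obtain ⟨w, hw, hwz⟩ := hroots z hz
    let π := QuotientGroup.mk' ⁅H, (⊤ : Subgroup G)⁆
    have h_err : π ((g * w) ^ n) = π (g ^ n * z) :=
      calc π ((g * w) ^ n) = π g ^ n * π w ^ n := by
            rw [map_pow, map_mul, (commute_mk'_commutator hw (π g)).symm.mul_pow]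
        _ = π g ^ n * π z := by rw [← map_pow π w, show π (w ^ n) = π z from QuotientGroup.eq.2 hwz]
        _ = π (g ^ n * z) := by rw [map_mul, map_pow]
    obtain ⟨v, hv, hvw⟩ := ih ⁅H, ⊤⁆ inferInstance (commutator_mono hle le_rfl)
      hroots.commutator (g * w) _ (QuotientGroup.eq.1 h_err)
    refine ⟨w * v, mul_mem hw (commutator_le_left _ _ hv), ?_⟩
    rw [← mul_assoc, hvw, mul_inv_cancel_left]

end Roots

section Dilation

variable {G : Type*} [Group G]

/-- The automorphism `δ` of `G` is an `n`-dilation: it induces the `n`-th power map on the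
abelianization, like the dilations of a graded nilpotent Lie group. -/
def IsDilation (n : ℕ) (δ : G ≃* G) : Prop :=
  ∀ g, Abelianization.of (δ g) = Abelianization.of g ^ n

namespace IsDilation

variable {n : ℕ} {δ : G ≃* G}

theorem mk_apply_commutatorElement (hδ : IsDilation n δ) {H : Subgroup G} [H.Normal] {a : G}
    (ha : a ∈ H) {m : ℕ} (ham : (a ^ m)⁻¹ * δ a ∈ ⁅H, (⊤ : Subgroup G)⁆) (b : G) :
    QuotientGroup.mk' ⁅⁅H, (⊤ : Subgroup G)⁆, (⊤ : Subgroup G)⁆ (δ ⁅a, b⁆) =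
      QuotientGroup.mk' ⁅⁅H, (⊤ : Subgroup G)⁆, (⊤ : Subgroup G)⁆ ⁅a, b⁆ ^ (n * m) := by
  let π := QuotientGroup.mk' ⁅⁅H, (⊤ : Subgroup G)⁆, (⊤ : Subgroup G)⁆
  have h_comm : ∀ y, ⁅π a, y⁆ ∈ center (G ⧸ ⁅⁅H, (⊤ : Subgroup G)⁆, (⊤ : Subgroup G)⁆) := by
    intro y
    obtain ⟨b, rfl⟩ := QuotientGroup.mk'_surjective _ y
    rw [← map_commutatorElement]
    exact mem_center_iff.2 fun y =>
      (commute_mk'_commutator (commutator_mem_commutator ha (mem_top b)) y).symm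
  calc π (δ ⁅a, b⁆) = ⁅π a ^ m * π ((a ^ m)⁻¹ * δ a), π (δ b)⁆ := by
        rw [← map_pow, ← map_mul, mul_inv_cancel_left, map_commutatorElement,
          map_commutatorElement]
    _ = ⁅π a ^ m, π (δ b)⁆ :=
        commutatorElement_mul_left_of_commute (commute_mk'_commutator ham _) _
    _ = ⁅π a, π (δ b)⁆ ^ m :=
        commutatorElement_pow_left (mem_center_iff.1 (h_comm (π (δ b))) (π a)).symm m
    _ = (⁅π a, π b⁆ ^ n) ^ m := by
        rw [commutatorElement_eq_pow_of_abelianization h_comm (b := π b)]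
        exact congrArg (Abelianization.map π) (hδ b)
    _ = π ⁅a, b⁆ ^ (n * m) := by rw [← pow_mul, map_commutatorElement]

theorem mk_apply_lowerCentralSeries (hδ : IsDilation n δ) (i : ℕ) :
    ∀ g ∈ (⊤ : Subgroup G).lowerCentralSeries i,
      QuotientGroup.mk' ((⊤ : Subgroup G).lowerCentralSeries (i + 1)) (δ g) =
        QuotientGroup.mk' ((⊤ : Subgroup G).lowerCentralSeries (i + 1)) g ^ n ^ (i + 1) := by
  induction i with
  | zero =>
    intro g _
    rw [zero_add, pow_one]
    exact hδ g
  | succ i ih =>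
    intro g hg
    rw [Subgroup.lowerCentralSeries_succ, Subgroup.commutator_def] at hg
    induction hg using closure_induction with
    | mem g hg =>
      obtain ⟨a, ha, b, -, rfl⟩ := hg
      rw [pow_succ' n]
      exact hδ.mk_apply_commutatorElement ha (QuotientGroup.eq.1 (ih a ha).symm) b
    | one => simp only [map_one, one_pow]
    | mul x y hx _ hx' hy' =>
      let π := QuotientGroup.mk' ((⊤ : Subgroup G).lowerCentralSeries (i + 2))
      have h_comm : Commute (π x) (π y) :=
        commute_mk'_commutator (H := (⊤ : Subgroup G).lowerCentralSeries (i + 1)) hx (π y)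
      rw [map_mul, map_mul, hx', hy', map_mul, h_comm.mul_pow]
    | inv x _ hx' => rw [map_inv, map_inv, hx', map_inv, inv_pow]

theorem mem_lowerCentralSeries_succ_of_pow_mem (hδ : IsDilation n δ) {i : ℕ} {z : G}
    (hz : z ∈ (⊤ : Subgroup G).lowerCentralSeries i)
    (hzn : z ^ n ∈ (⊤ : Subgroup G).lowerCentralSeries (i + 1)) :
    z ∈ (⊤ : Subgroup G).lowerCentralSeries (i + 1) := by
  have h_apply : δ z ∈ (⊤ : Subgroup G).lowerCentralSeries (i + 1) := by
    rw [← QuotientGroup.eq_one_iff]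
    refine (hδ.mk_apply_lowerCentralSeries i z hz).trans ?_
    rw [pow_succ', pow_mul, ← map_pow, show QuotientGroup.mk' _ (z ^ n) = 1 from
      (QuotientGroup.eq_one_iff _).2 hzn, one_pow]
  have h_char : ((⊤ : Subgroup G).lowerCentralSeries (i + 1)).Characteristic := inferInstance
  rw [← h_char.fixed δ]
  exact h_apply

theorem pow_injective [hG : Group.IsNilpotent G] (hδ : IsDilation n δ) :
    Function.Injective fun g : G => g ^ n := by
  intro s t (hst : s ^ n = t ^ n)
  obtain ⟨c, hc⟩ := Subgroup.nilpotent_iff_lowerCentralSeries.1 hG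
  suffices h_mem : ∀ i, t⁻¹ * s ∈ (⊤ : Subgroup G).lowerCentralSeries i by
    have h_one := h_mem c
    rw [hc, mem_bot] at h_one
    exact (inv_mul_eq_one.1 h_one).symm
  intro i
  induction i with
  | zero => exact mem_top _
  | succ i ih =>
    refine hδ.mem_lowerCentralSeries_succ_of_pow_mem ih ?_
    let π := QuotientGroup.mk' ((⊤ : Subgroup G).lowerCentralSeries (i + 1))
    have h_comm : Commute (π t) (π (t⁻¹ * s)) := (commute_mk'_commutator ih (π t)).symm
    have h_pow : π s ^ n = π t ^ n * π (t⁻¹ * s) ^ n := by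
      rw [← h_comm.mul_pow, ← map_mul, mul_inv_cancel_left]
    rw [← map_pow, hst, map_pow, left_eq_mul, ← map_pow] at h_pow
    exact (QuotientGroup.eq_one_iff _).1 h_pow

theorem hasRootsModCommutator_top (hδ : IsDilation n δ) :
    HasRootsModCommutator n (⊤ : Subgroup G) := by
  intro z _
  refine ⟨δ.symm z, mem_top _, QuotientGroup.eq.1 ?_⟩
  rw [QuotientGroup.mk_pow]
  exact (hδ (δ.symm z)).symm.trans (congrArg Abelianization.of (δ.apply_symm_apply z))

theorem pow_bijective [Group.IsNilpotent G] (hδ : IsDilation n δ) :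
    Function.Bijective fun g : G => g ^ n :=
  ⟨hδ.pow_injective, fun g => by
    simpa using hδ.hasRootsModCommutator_top.exists_pow_eq g (mem_top g)⟩

end IsDilation

theorem mem_commutator_of_pow_mem [Group.IsNilpotent G] {n : ℕ}
    (hG : Function.Bijective fun g : G => g ^ n) {H : Subgroup G} [H.Normal]
    (hH : ∀ g, g ^ n ∈ H → g ∈ H) {g : G} (hg : g ^ n ∈ ⁅H, (⊤ : Subgroup G)⁆) :
    g ∈ ⁅H, (⊤ : Subgroup G)⁆ := by
  have h_roots : HasRootsModCommutator n H := by
    intro z hz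
    obtain ⟨w, rfl⟩ := hG.2 z
    exact ⟨w, hH w hz, by simp⟩
  obtain ⟨w, hw, hwg⟩ := h_roots.commutator.exists_pow_eq _ hg
  rwa [← hG.1 hwg]

end Dilation

section PowerSequences

theorem isDilation_of_closure_eq_top {G : Type*} [Group G] {n : ℕ} {δ : G ≃* G} {s : Set G}
    (hs : Subgroup.closure s = ⊤) (h : ∀ g ∈ s, δ g = g ^ n) : IsDilation n δ := by
  have h_eq : (Abelianization.of).comp δ.toMonoidHom = (powMonoidHom n).comp Abelianization.of :=
    MonoidHom.eq_of_eqOn_dense hs fun g hg =>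
      (congrArg Abelianization.of (h g hg)).trans (map_pow _ g n)
  exact DFunLike.congr_fun h_eq

variable (R : Type*) [Group R] (p : ℕ)

/-- The subgroup of `ℤ → R` generated by the sequences of iterated `p`-th powers. It covers `R` by
evaluation at `0`, and, unlike `R` in general, it has a `p`-dilation, namely the shift. -/
def powerSequenceGroup : Subgroup (ℤ → R) :=
  Subgroup.closure {f | ∀ i, f (i + 1) = f i ^ p}

namespace powerSequenceGroup

instance [Group.IsNilpotent R] : Group.IsNilpotent (powerSequenceGroup R p) :=
  have : Group.IsNilpotent (ℤ → R) := Group.isNilpotent_pi_of_bounded_class _ fun _ => le_rfl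
  inferInstance

/-- The automorphism `f ↦ (i ↦ f (i + 1))`. -/
def shift : powerSequenceGroup R p ≃* powerSequenceGroup R p :=
  let σ : (ℤ → R) ≃* (ℤ → R) := MulEquiv.arrowCongr (Equiv.subRight 1) (MulEquiv.refl R)
  (σ.subgroupMap _).trans <| MulEquiv.subgroupCongr <| by
    refine (MonoidHom.map_closure _ _).trans (congrArg _ ?_)
    ext f
    constructor
    · rintro ⟨g, hg, rfl⟩ i
      exact hg (i + 1)
    · exact fun hf => ⟨fun i => f (i - 1), fun i => by simpa using hf (i - 1), by ext i; simp [σ]⟩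

theorem isDilation_shift : IsDilation p (shift R p) := by
  refine isDilation_of_closure_eq_top Subgroup.closure_closure_coe_preimage ?_
  exact fun f hf => Subtype.ext (funext hf)

/-- Evaluation of sequences at `0`. -/
def evalZero : powerSequenceGroup R p →* R :=
  (Pi.evalMonoidHom (fun _ => R) 0).comp (powerSequenceGroup R p).subtype

variable {R p} in
theorem evalZero_surjective (h : Function.Surjective fun r : R => r ^ p) :
    Function.Surjective (evalZero R p) := by
  intro r
  choose root h_root using h
  let f : ℤ → R := fun i => (root^[(-i).toNat] r) ^ p ^ i.toNat
  have hf : ∀ i, f (i + 1) = f i ^ p := by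
    intro i
    rcases le_or_gt 0 i with hi | hi
    · have h_toNat : (i + 1).toNat = i.toNat + 1 := by omega
      simp only [f, h_toNat, show (-(i + 1)).toNat = 0 by omega, show (-i).toNat = 0 by omega,
        Function.iterate_zero, id_eq, pow_succ, pow_mul]
    · have h_toNat : (-i).toNat = (-(i + 1)).toNat + 1 := by omega
      simp only [f, h_toNat, show (i + 1).toNat = 0 by omega, show i.toNat = 0 by omega,
        Function.iterate_succ_apply', pow_zero, pow_one, h_root]
  exact ⟨⟨f, Subgroup.subset_closure hf⟩, by simp [evalZero, f]⟩

variable {X : Type*} [Group X] [MulDistribMulAction X R]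

variable {R p} in
theorem smul_mem (x : X) {f : ℤ → R} (hf : f ∈ powerSequenceGroup R p) :
    x • f ∈ powerSequenceGroup R p := by
  suffices powerSequenceGroup R p ≤
      (powerSequenceGroup R p).comap (MulDistribMulAction.toMonoidHom (ℤ → R) x) from this hf
  refine (Subgroup.closure_le _).2 fun g hg => Subgroup.subset_closure fun i => ?_
  exact (congrArg (x • ·) (hg i)).trans (smul_pow' x (g i) p)

instance : SMul X (powerSequenceGroup R p) :=
  ⟨fun x f => ⟨x • (f : ℤ → R), smul_mem x f.2⟩⟩

instance : MulDistribMulAction X (powerSequenceGroup R p) :=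
  Function.Injective.mulDistribMulAction (powerSequenceGroup R p).subtype
    (powerSequenceGroup R p).subtype_injective fun _ _ => rfl

end powerSequenceGroup

end PowerSequences

section Quotients

variable {X G : Type*} [Group X] [Group G] [MulDistribMulAction X G]

/-- The action of `X` by automorphisms induced on the quotient by an invariant normal subgroup. -/
abbrev quotientMulDistribMulAction (N : Subgroup G) [N.Normal]
    (hN : ∀ (x : X), ∀ g ∈ N, x • g ∈ N) : MulDistribMulAction X (G ⧸ N) :=
  letI : MulAction.QuotientAction X N := ⟨fun x a b hab => by
    simpa only [smul_mul', smul_inv'] using hN x _ hab⟩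
  Function.Surjective.mulDistribMulAction (QuotientGroup.mk' N) (QuotientGroup.mk'_surjective N)
    fun _ _ => rfl

theorem smul_mem_commutator_top {H : Subgroup G} (hH : ∀ (x : X), ∀ g ∈ H, x • g ∈ H) (x : X)
    {g : G} (hg : g ∈ ⁅H, (⊤ : Subgroup G)⁆) : x • g ∈ ⁅H, (⊤ : Subgroup G)⁆ := by
  let f := MulDistribMulAction.toMonoidHom G x
  have h_map : ⁅H, (⊤ : Subgroup G)⁆.map f ≤ ⁅H, (⊤ : Subgroup G)⁆ := by
    rw [map_commutator]
    exact commutator_mono (map_le_iff_le_comap.2 fun g hg => hH x g hg) le_top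
  exact h_map (mem_map_of_mem f hg)

end Quotients

section CentralRootCover

theorem bijOn_pow_map_mk'_commutator {G : Type*} [Group G] [Group.IsNilpotent G] {n : ℕ}
    (hG : Function.Bijective fun g : G => g ^ n) {H : Subgroup G} [H.Normal]
    (hH : ∀ g, g ^ n ∈ H → g ∈ H) :
    Set.BijOn (· ^ n) (QuotientGroup.mk' ⁅H, (⊤ : Subgroup G)⁆ '' H)
      (QuotientGroup.mk' ⁅H, (⊤ : Subgroup G)⁆ '' H) := by
  refine ⟨?_, ?_, ?_⟩
  · rintro _ ⟨s, hs, rfl⟩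
    exact ⟨s ^ n, pow_mem hs n, map_pow _ s n⟩
  · rintro _ ⟨s, -, rfl⟩ _ ⟨t, ht, rfl⟩ hst
    let π := QuotientGroup.mk' ⁅H, (⊤ : Subgroup G)⁆
    have h_comm : Commute (π t)⁻¹ (π s) := (commute_mk'_commutator ht (π s)).inv_left
    have h_pow : π ((t⁻¹ * s) ^ n) = 1 := by
      rw [map_pow, map_mul, map_inv, h_comm.mul_pow, inv_pow, inv_mul_eq_one]
      exact hst.symm
    exact (QuotientGroup.eq.2
      (mem_commutator_of_pow_mem hG hH ((QuotientGroup.eq_one_iff _).1 h_pow))).symm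
  · rintro _ ⟨s, hs, rfl⟩
    obtain ⟨w, rfl⟩ := hG.2 s
    exact ⟨QuotientGroup.mk' _ w, mem_map_of_mem _ (hH w hs), (map_pow _ w n).symm⟩

instance {R : Type*} [Group R] [Group.IsNilpotent R] : (nilTorsion R).Normal :=
  ⟨fun _ hu g => (MulAut.conj g).toMonoidHom.isOfFinOrder hu⟩

/-- `φ : E → R` is an epimorphism of `X`-groups such that the preimage in `E` of the torsion
subgroup of `R` is central and uniquely `p`-divisible. -/
structure IsCentralRootCover (X : Type*) [Group X] (p : ℕ)
    {R : Type*} [Group R] [Group.IsNilpotent R] [MulDistribMulAction X R]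
    {E : Type*} [Group E] [MulDistribMulAction X E] (φ : E →* R) : Prop where
  surjective : Function.Surjective φ
  equivariant : ∀ (x : X) (e : E), φ (x • e) = x • φ e
  comap_le_center : (nilTorsion R).comap φ ≤ center E
  bijOn_pow : Set.BijOn (· ^ p) ((nilTorsion R).comap φ : Set E) ((nilTorsion R).comap φ)

variable {X : Type v} [Group X] {R : Type*} [Group R] [Group.IsNilpotent R]
  [MulDistribMulAction X R] {p : ℕ}

theorem exists_isCentralRootCover_of_pow_bijective {G : Type u} [Group G] [Group.IsNilpotent G]
    [MulDistribMulAction X G] (hR : nilTorsion R ≤ center R) (hp : p ≠ 0)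
    (hG : Function.Bijective fun g : G => g ^ p) {φ : G →* R} (h_surj : Function.Surjective φ)
    (h_equiv : ∀ (x : X) (g : G), φ (x • g) = x • φ g) :
    ∃ (E : Type u) (_ : Group E) (_ : MulDistribMulAction X E) (π : E →* R),
      IsCentralRootCover X p π := by
  let S := (nilTorsion R).comap φ
  have : S.Normal := normal_comap φ
  have h_root : ∀ g, g ^ p ∈ S → g ∈ S := fun g (hg : IsOfFinOrder (φ (g ^ p))) =>
    show IsOfFinOrder (φ g) from (isOfFinOrder_pow.1 (map_pow φ g p ▸ hg)).resolve_right hp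
  have h_ker : ⁅S, (⊤ : Subgroup G)⁆ ≤ φ.ker := by
    refine commutator_le.2 fun s hs g _ => ?_
    rw [MonoidHom.mem_ker, map_commutatorElement, commutatorElement_eq_one_iff_commute]
    exact (mem_center_iff.1 (hR hs) (φ g)).symm
  have h_smul : ∀ (x : X), ∀ s ∈ S, x • s ∈ S := fun x s hs => by
    change φ (x • s) ∈ nilTorsion R
    exact h_equiv x s ▸ smul_mem_nilTorsion x hs
  let E := G ⧸ ⁅S, (⊤ : Subgroup G)⁆
  let _ : MulDistribMulAction X E :=
    quotientMulDistribMulAction _ fun x _ => smul_mem_commutator_top h_smul x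
  refine ⟨E, inferInstance, inferInstance, QuotientGroup.lift _ φ h_ker, ?_⟩
  constructor
  case surjective => exact QuotientGroup.lift_surjective_of_surjective _ φ h_surj h_ker
  case equivariant =>
    intro x e
    induction e using QuotientGroup.induction_on with
    | H g => exact h_equiv x g
  case comap_le_center =>
    intro e he
    induction e using QuotientGroup.induction_on with
    | H s => exact mem_center_iff.2 fun y => (commute_mk'_commutator (H := S) he y).symm
  case bijOn_pow =>
    rw [← map_comap_eq_self_of_surjective (QuotientGroup.mk'_surjective ⁅S, (⊤ : Subgroup G)⁆)
      ((nilTorsion R).comap _)]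
    exact bijOn_pow_map_mk'_commutator hG h_root

end CentralRootCover

section PowerCover

theorem exists_mulEquiv_of_ker_eq {A B C : Type*} [Group A] [Group B] [Group C] {α : A →* B}
    {β : A →* C} (hα : Function.Surjective α) (hβ : Function.Surjective β)
    (h_ker : α.ker = β.ker) : ∃ ν : B ≃* C, ∀ a, ν (α a) = β a := by
  let ν := ((QuotientGroup.quotientKerEquivOfSurjective α hα).symm.trans
    (QuotientGroup.quotientMulEquivOfEq h_ker)).trans
    (QuotientGroup.quotientKerEquivOfSurjective β hβ)
  refine ⟨ν, fun a => ?_⟩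
  have h_symm : (QuotientGroup.quotientKerEquivOfSurjective α hα).symm (α a) = a :=
    (MulEquiv.symm_apply_eq _).2 rfl
  simp only [ν, MulEquiv.trans_apply, h_symm]
  rfl

/-- The subgroup of the `n`-th powers of the central elements of `K`. -/
def centralPowers {G : Type*} [Group G] (n : ℕ) (K : Subgroup G) : Subgroup G :=
  ((K.subgroupOf (center G)).map (powMonoidHom n)).map (center G).subtype

namespace centralPowers

variable {G : Type*} [Group G] {n : ℕ} {K : Subgroup G}

theorem mem_iff (hK : K ≤ center G) {g : G} : g ∈ centralPowers n K ↔ ∃ k ∈ K, k ^ n = g := by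
  constructor
  · rintro ⟨-, ⟨k, hk, rfl⟩, rfl⟩
    exact ⟨k, hk, rfl⟩
  · rintro ⟨k, hk, rfl⟩
    exact ⟨_, ⟨⟨k, hK hk⟩, hk, rfl⟩, rfl⟩

instance : (centralPowers n K).Normal where
  conj_mem := by
    rintro _ ⟨z, hz, rfl⟩ g
    have h_conj : g * z * g⁻¹ = z := by rw [mem_center_iff.1 z.2 g, mul_inv_cancel_right]
    exact h_conj.symm ▸ mem_map_of_mem _ hz

theorem le (hK : K ≤ center G) : centralPowers n K ≤ K := by
  intro g hg
  obtain ⟨k, hk, rfl⟩ := (mem_iff hK).1 hg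
  exact pow_mem hk n

theorem smul_mem {X : Type*} [Group X] [MulDistribMulAction X G] (hK : K ≤ center G)
    (h_smul : ∀ (x : X), ∀ k ∈ K, x • k ∈ K) (x : X) {g : G} (hg : g ∈ centralPowers n K) :
    x • g ∈ centralPowers n K := by
  obtain ⟨k, hk, rfl⟩ := (mem_iff hK).1 hg
  exact (mem_iff hK).2 ⟨x • k, h_smul x k hk, (smul_pow' x k n).symm⟩

end centralPowers

theorem exists_mulEquiv_comap_lift_centralPowers {E R : Type*} [Group E] [Group R] {n : ℕ}
    {φ : E →* R} (hφ : Function.Surjective φ) {P : Subgroup R} (h_center : P.comap φ ≤ center E)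
    (h_bij : Set.BijOn (· ^ n) (P.comap φ : Set E) (P.comap φ))
    (h_le : centralPowers n φ.ker ≤ φ.ker) :
    ∃ ν : P ≃* P.comap (QuotientGroup.lift (centralPowers n φ.ker) φ h_le),
      ∀ (e : E) (u : P), φ e = u →
        (ν u : E ⧸ centralPowers n φ.ker) = QuotientGroup.mk' _ (e ^ n) := by
  have h_ker : φ.ker ≤ P.comap φ := fun k hk =>
    mem_comap.2 ((MonoidHom.mem_ker.1 hk).symm ▸ P.one_mem)
  let β : P.comap φ →* P.comap (QuotientGroup.lift (centralPowers n φ.ker) φ h_le) :=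
    MonoidHom.mk' (fun e => ⟨QuotientGroup.mk' _ (e ^ n : E), pow_mem e.2 n⟩) fun e f =>
      Subtype.ext <| congrArg (QuotientGroup.mk' _)
        (Commute.mul_pow (mem_center_iff.1 (h_center f.2) e) n)
  have hβ : Function.Surjective β := by
    rintro ⟨e, he⟩
    induction e using QuotientGroup.induction_on with
    | H e =>
      obtain ⟨f, hf, rfl⟩ := h_bij.surjOn he
      exact ⟨⟨f, hf⟩, rfl⟩
  have h_ker_eq : (φ.subgroupComap P).ker = β.ker := by
    ext e
    have h_left : e ∈ (φ.subgroupComap P).ker ↔ (e : E) ∈ φ.ker := Subtype.ext_iff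
    have h_right : e ∈ β.ker ↔ (e ^ n : E) ∈ centralPowers n φ.ker :=
      Subtype.ext_iff.trans (QuotientGroup.eq_one_iff _)
    rw [h_left, h_right, centralPowers.mem_iff (h_ker.trans h_center)]
    constructor
    · exact fun he => ⟨e, he, rfl⟩
    · rintro ⟨k, hk, h_pow⟩
      rwa [← h_bij.injOn (h_ker hk) e.2 h_pow]
  obtain ⟨ν, hν⟩ :=
    exists_mulEquiv_of_ker_eq (φ.subgroupComap_surjective_of_surjective P hφ) hβ h_ker_eq
  refine ⟨ν, ?_⟩
  rintro e ⟨_, he⟩ rfl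
  exact congrArg Subtype.val (hν ⟨e, he⟩)

theorem IsRadicable.of_ker_le {G H : Type*} [Group G] [Group H] (hH : IsRadicable H) {f : G →* H}
    (hf : Function.Surjective f) {A : Subgroup G} (h_ker : f.ker ≤ A) (h_center : A ≤ center G)
    (hA : IsRadicable A) : IsRadicable G := by
  intro n hn g
  obtain ⟨h, hh⟩ := hH n hn (f g)
  obtain ⟨w, rfl⟩ := hf h
  have h_err : (w ^ n)⁻¹ * g ∈ f.ker := by
    rw [MonoidHom.mem_ker, map_mul, map_inv, map_zpow, hh, inv_mul_cancel]
  obtain ⟨a, ha⟩ := hA n hn ⟨_, h_ker h_err⟩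
  have ha : (a : G) ^ n = (w ^ n)⁻¹ * g := congrArg Subtype.val ha
  have h_comm : Commute w a := mem_center_iff.1 (h_center a.2) w
  exact ⟨w * a, by rw [h_comm.mul_zpow, ha, mul_inv_cancel_left]⟩

theorem isRadicable_nilTorsion {G : Type*} [Group G] [Group.IsNilpotent G] (hG : IsRadicable G) :
    IsRadicable (nilTorsion G) := by
  intro n hn u
  obtain ⟨w, hw⟩ := hG n hn u
  obtain ⟨m, hm, hum⟩ := isOfFinOrder_iff_zpow_eq_one.1 u.2
  have h_fin : IsOfFinOrder w :=
    isOfFinOrder_iff_zpow_eq_one.2 ⟨n * m, mul_ne_zero hn hm, by rw [zpow_mul, hw, hum]⟩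
  exact ⟨⟨w, h_fin⟩, Subtype.ext hw⟩

theorem comap_lift_le_center {G H : Type*} [Group G] [Group H] {N : Subgroup G} [N.Normal]
    {f : G →* H} (hN : N ≤ f.ker) {A : Subgroup H} (hA : A.comap f ≤ center G) :
    A.comap (QuotientGroup.lift N f hN) ≤ center (G ⧸ N) := by
  intro a ha
  induction a using QuotientGroup.induction_on with
  | H a =>
    refine mem_center_iff.2 fun g => ?_
    induction g using QuotientGroup.induction_on with
    | H g => exact congrArg (QuotientGroup.mk' N) (mem_center_iff.1 (hA ha) g)

theorem IsCentralRootCover.exists_isPowerCover {X : Type v} [Group X] {R : Type*} [Group R]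
    [Group.IsNilpotent R] [MulDistribMulAction X R] {p : ℕ} (hR : IsRadicable R) {E : Type u}
    [Group E] [MulDistribMulAction X E] {φ : E →* R} (hφ : IsCentralRootCover X p φ) :
    ∃ (Rbar : Type u) (_ : Group Rbar) (_ : MulDistribMulAction X Rbar) (ψ : Rbar →* R),
      IsPowerCover X p ψ := by
  have h_ker_le : φ.ker ≤ (nilTorsion R).comap φ := comap_mono bot_le
  have h_ker_center := h_ker_le.trans hφ.comap_le_center
  have h_smul : ∀ (x : X), ∀ k ∈ φ.ker, x • k ∈ φ.ker := fun x k hk => by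
    rw [MonoidHom.mem_ker, hφ.equivariant, MonoidHom.mem_ker.1 hk, smul_one]
  let _ : MulDistribMulAction X (E ⧸ centralPowers p φ.ker) :=
    quotientMulDistribMulAction _ fun x _ => centralPowers.smul_mem h_ker_center h_smul x
  have h_le := centralPowers.le (n := p) h_ker_center
  let ψ := QuotientGroup.lift (centralPowers p φ.ker) φ h_le
  have hψ : Function.Surjective ψ := QuotientGroup.lift_surjective_of_surjective _ φ hφ.surjective _
  obtain ⟨ν, hν⟩ := exists_mulEquiv_comap_lift_centralPowers hφ.surjective hφ.comap_le_center
    hφ.bijOn_pow h_le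
  have h_center : (nilTorsion R).comap ψ ≤ center _ :=
    comap_lift_le_center h_le hφ.comap_le_center
  have h_ker : ψ.ker ≤ (nilTorsion R).comap ψ := comap_mono bot_le
  refine ⟨_, inferInstance, inferInstance, ψ, ?_⟩
  constructor
  case nilpotent => exact Subgroup.isNilpotent_of_ker_le_center ψ (h_ker.trans h_center)
  case radicable =>
    exact hR.of_ker_le hψ h_ker h_center
      ((isRadicable_nilTorsion hR).of_surjective (f := ν.toMonoidHom) ν.surjective)
  case surjective => exact hψ
  case equivariant =>
    intro x e
    induction e using QuotientGroup.induction_on with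
    | H e => exact hφ.equivariant x e
  case exists_iso =>
    refine ⟨ν, fun x u => ?_, fun u => ?_⟩ <;> obtain ⟨e, heu⟩ := hφ.surjective u
    · have h_smul_eq : φ (x • e) = x • (u : R) := by rw [hφ.equivariant, heu]
      rw [hν e u heu, hν (x • e) _ h_smul_eq, ← smul_pow']
      rfl
    · rw [hν e u heu, ← heu]
      exact map_pow φ e p

end PowerCover

section Annihilator

theorem annihilator_eq_of_nsmul_surjective {A M N : Type*} [Semiring A] [AddCommMonoid M]
    [AddCommMonoid N] [Module A M] [Module A N] {f : M →ₗ[A] N} (hf : Function.Surjective f)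
    {n : ℕ} (hM : Function.Surjective fun m : M => n • m) (h_ker : ∀ m, f m = 0 → n • m = 0) :
    Module.annihilator A M = Module.annihilator A N := by
  refine le_antisymm (f.annihilator_le_of_surjective hf) fun a ha => ?_
  refine Module.mem_annihilator.2 fun m => ?_
  obtain ⟨m, rfl⟩ := hM m
  have h_map : f (a • m) = 0 := by rw [map_smul, Module.mem_annihilator.1 ha]
  exact (smul_comm a n m).trans (h_ker _ h_map)

variable {X G H : Type*} [Group X] [Group G] [Group H] [MulDistribMulAction X G]
  [MulDistribMulAction X H]

/-- The `ℤX`-linear map of abelianizations induced by a homomorphism of `X`-groups. -/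
noncomputable def abelianizationLinearMap (f : G →* H)
    (hf : ∀ (x : X) (g : G), f (x • g) = x • f g) :
    (abelianizationRep X G).asModule →ₗ[MonoidAlgebra ℤ X] (abelianizationRep X H).asModule :=
  let F := (MonoidHom.toAdditive (Abelianization.map f)).toIntLinearMap
  Representation.IntertwiningMap.equivLinearMapAsModule _ _ <|
    F.intertwiningMap_of_isIntertwiningMap _ _ fun x v => by
      obtain ⟨g, rfl⟩ := QuotientGroup.mk_surjective v.toMul
      exact congrArg (fun t : H => Additive.ofMul (Abelianization.of t)) (hf x g)

theorem exists_mem_ker_of_abelianization_map_eq_one {f : G →* H} (hf : Function.Surjective f)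
    {a : Abelianization G} (ha : Abelianization.map f a = 1) :
    ∃ k ∈ f.ker, Abelianization.of k = a := by
  obtain ⟨g, rfl⟩ := QuotientGroup.mk_surjective a
  have h_comm : f g ∈ (commutator G).map f := by
    rw [commutator_def, map_commutator, map_top_of_surjective f hf]
    exact (QuotientGroup.eq_one_iff _).1 ha
  obtain ⟨c, hc, hcg⟩ := h_comm
  refine ⟨c⁻¹ * g, ?_, ?_⟩
  · rw [MonoidHom.mem_ker, map_mul, map_inv, hcg, inv_mul_cancel]
  · have hc_one : Abelianization.of c = 1 := (QuotientGroup.eq_one_iff c).2 hc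
    rw [map_mul, map_inv, hc_one, inv_one, one_mul]
    rfl

end Annihilator

theorem IsPowerCover.pow_eq_one_of_mem_ker {X : Type*} [Group X] {p : ℕ} {R Rbar : Type*} [Group R]
    [Group.IsNilpotent R] [MulDistribMulAction X R] [Group Rbar] [MulDistribMulAction X Rbar]
    {ψ : Rbar →* R} (h : IsPowerCover X p ψ) {k : Rbar} (hk : k ∈ ψ.ker) : k ^ p = 1 := by
  obtain ⟨ν, -, hν⟩ := h.exists_iso
  obtain ⟨u, hu⟩ := ν.surjective ⟨k, comap_mono (f := ψ) bot_le hk⟩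
  have hu_pow : u ^ p = 1 := by
    refine Subtype.ext ((hν u).symm.trans ?_)
    rw [hu]
    exact hk
  calc k ^ p = ν u ^ p := by rw [hu]
    _ = 1 := congrArg Subtype.val (by rw [← map_pow, hu_pow, map_one] : ν u ^ p = 1)

theorem IsPowerCover.abAnnihilator_eq {X : Type*} [Group X] {p : ℕ} (hp : p ≠ 0)
    {R Rbar : Type*} [Group R] [Group.IsNilpotent R] [MulDistribMulAction X R] [Group Rbar]
    [MulDistribMulAction X Rbar] {ψ : Rbar →* R} (h : IsPowerCover X p ψ) :
    abAnnihilator X Rbar = abAnnihilator X R := by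
  have h_surj : Function.Surjective (abelianizationLinearMap ψ h.equivariant) := by
    intro v
    obtain ⟨r, hr⟩ := QuotientGroup.mk'_surjective (commutator R) (Additive.toMul v)
    obtain ⟨s, rfl⟩ := h.surjective r
    exact ⟨Additive.ofMul (Abelianization.of s), hr⟩
  refine annihilator_eq_of_nsmul_surjective h_surj (n := p) (fun v => ?_) fun v hv => ?_
  · obtain ⟨r, hr⟩ := h.radicable.of_surjective (QuotientGroup.mk'_surjective (commutator Rbar))
      p (mod_cast hp) (Additive.toMul v)
    exact ⟨Additive.ofMul r, (zpow_natCast r p).symm.trans hr⟩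
  · obtain ⟨k, hk, hkv⟩ := exists_mem_ker_of_abelianization_map_eq_one (a := Additive.toMul v)
      h.surjective hv
    have hv_pow : Additive.toMul v ^ p = 1 := by
      rw [← hkv, ← map_pow, h.pow_eq_one_of_mem_ker hk, map_one]
    exact hv_pow

theorem IsRadicable.exists_isPowerCover {X : Type v} [Group X] {R : Type u} [Group R]
    [Group.IsNilpotent R] [MulDistribMulAction X R] (hR : IsRadicable R) {p : ℕ} (hp : p ≠ 0) :
    ∃ (Rbar : Type u) (_ : Group Rbar) (_ : MulDistribMulAction X Rbar) (ψ : Rbar →* R),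
      IsPowerCover X p ψ := by
  have h_root : Function.Surjective fun r : R => r ^ p := fun r => by
    obtain ⟨s, hs⟩ := hR p (mod_cast hp) r
    exact ⟨s, (zpow_natCast s p).symm.trans hs⟩
  obtain ⟨E, _, _, φ, hφ⟩ := exists_isCentralRootCover_of_pow_bijective (X := X)
    (fun _ => hR.mem_center_of_isOfFinOrder) hp
    (powerSequenceGroup.isDilation_shift R p).pow_bijective
    (powerSequenceGroup.evalZero_surjective h_root) fun _ _ => rfl
  exact hφ.exists_isPowerCover hR

theorem proposition3p12_general {X : Type v} [Group X]
    {R : Type u} [Group R] [Group.IsNilpotent R] [MulDistribMulAction X R]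
    (hR : IsRadicable R) {p : ℕ} (hp : p ≠ 0) :
    (∃ (Rbar : Type u) (_ : Group Rbar) (_ : MulDistribMulAction X Rbar) (ψ : Rbar →* R),
      IsPowerCover X p ψ ∧ abAnnihilator X Rbar = abAnnihilator X R) ∧
    (∀ (Rbar : Type u) [Group Rbar] [MulDistribMulAction X Rbar] (ψ : Rbar →* R),
      IsPowerCover X p ψ → abAnnihilator X Rbar = abAnnihilator X R) := by
  refine ⟨?_, fun Rbar _ _ ψ hψ => hψ.abAnnihilator_eq hp⟩
  obtain ⟨Rbar, _, _, ψ, hψ⟩ := hR.exists_isPowerCover (X := X) hp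
  exact ⟨Rbar, _, _, ψ, hψ, hψ.abAnnihilator_eq hp⟩

theorem proposition3p12 {X : Type v} [Group X]
    {R : Type u} [Group R] [Group.IsNilpotent R] [MulDistribMulAction X R]
    (hR : IsRadicable R) (p : ℕ) (hp : p.Prime)
    (hP : IsPiMinimax {p} (nilTorsion R)) :
    (∃ (Rbar : Type u) (_ : Group Rbar) (_ : MulDistribMulAction X Rbar) (ψ : Rbar →* R),
      IsPowerCover X p ψ ∧ abAnnihilator X Rbar = abAnnihilator X R) ∧
    (∀ (Rbar : Type u) [Group Rbar] [MulDistribMulAction X Rbar] (ψ : Rbar →* R),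
      IsPowerCover X p ψ → abAnnihilator X Rbar = abAnnihilator X R) :=
  proposition3p12_general hR hp.ne_zero
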